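/- Let $n\ge 0$ and work in $\mathbb R^n$ with its Euclidean structure and Lebesgue measure $|\cdot|$; a convex body is a nonempty compact convex set $K\subset\mathbb R^n$ (possibly with empty interior), and $h_K(x)=\sup_{y\in K}x\cdot y$ is its support function. Superforms are differential forms in $dx_1,\dots,dx_n,d\xi_1,\dots,d\xi_n$ whose coefficients depend only on $x$; for a smooth function $\psi$, $d^\#\psi=\sum_k \frac{\partial\psi}{\partial x_k}\,d\xi_k$ and $dd^\#\psi=\sum_{j,k}\frac{\partial^2\psi}{\partial x_j\partial x_k}\,dx_j\wedge d\xi_k$, and the superintegral is normalized by $\int f\,dx_1\wedge d\xi_1\wedge\dots\wedge dx_n\wedge d\xi_n=\int_{\mathbb R^n} f\,dx$. For a convex function $\psi$ on $\mathbb R^n$, $MA(\psi)=(dd^\#\psi)^n/n!$ denotes the locally finite Borel measure $\mu$ such that, whenever smooth convex functions $\varphi_i$ converge to $\psi$ locally uniformly, $\int\chi\,(dd^\#\varphi_i)^n/n!\to\int\chi\,d\mu$ for every smooth function $\chi$ with compact support. A convex function $\psi$ is of linear growth if $\psi(x)\le A|x|+B$ for some constants $A,B$. **Theorem.** (1) Let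 $\psi$ be a convex function on $\mathbb R^n$ of linear growth. Then the measure $MA(\psi)$ exists and is unique, the limit $\psi^\circ(x)=\lim_{t\to\infty}\psi(tx)/t$ exists in $\mathbb R$ for every $x$ (the indicator function of $\psi$), there is a unique convex body $K$ with $\psi^\circ=h_K$, and $$\int_{\mathbb R^n}\frac{(dd^\#\psi)^n}{n!}=\int_{\mathbb R^n}MA(\psi)=|K|.$$ (2) Let $K$ be a convex body. Then $MA(h_K)$ is well defined in the same sense and $MA(h_K)=|K|\,\delta_0$, where $\delta_0$ is the unit Dirac mass at the origin. -/

import Mathlib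

open MeasureTheory Filter Topology
open scoped ContDiff

noncomputable section

namespace SuperForms

/-- The space `ℝⁿ` with its Euclidean structure. -/
abbrev E (n : ℕ) := EuclideanSpace ℝ (Fin n)

/-- Superforms at a point: the exterior algebra on the `2n` generators
`dx_1, dξ_1, …, dx_n, dξ_n`. The generators are indexed by pairs `(j, 0)` (for `dx_j`) and
`(j, 1)` (for `dξ_j`); multiplication is the wedge product. -/
abbrev SForm (n : ℕ) := ExteriorAlgebra ℝ (Fin n × Fin 2 → ℝ)

/-- The generator `dx_j`. -/
def dx {n : ℕ} (j : Fin n) : SForm n := ExteriorAlgebra.ι ℝ (Pi.single (j, 0) 1)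

/-- The generator `dξ_k`. -/
def dxi {n : ℕ} (k : Fin n) : SForm n := ExteriorAlgebra.ι ℝ (Pi.single (k, 1) 1)

/-- The partial derivative `∂f/∂x_j`. -/
def pderiv {n : ℕ} (j : Fin n) (f : E n → ℝ) (x : E n) : ℝ :=
  fderiv ℝ f x (EuclideanSpace.single j 1)

/-- The coefficients `(∂ψ/∂x_k)_k` of the `(0,1)`-form `d^# ψ = ∑ k, (∂ψ/∂x_k) dξ_k`. -/
def dSharp {n : ℕ} (ψ : E n → ℝ) (k : Fin n) : E n → ℝ := pderiv k ψ

/-- The exterior derivative `d a = ∑ j k, (∂a_k/∂x_j) dx_j ∧ dξ_k` of the `(0,1)`-superform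
`∑ k, a_k(x) dξ_k`, whose coefficients do not depend on `ξ`. -/
def extD {n : ℕ} (a : Fin n → E n → ℝ) (x : E n) : SForm n :=
  ∑ j, ∑ k, pderiv j (a k) x • (dx j * dxi k)

/-- The `(1,1)`-superform `d d^# ψ`. -/
def ddSharp {n : ℕ} (ψ : E n → ℝ) : E n → SForm n := extD (dSharp ψ)

/-- The coefficient of the volume form `dx_1 ∧ dξ_1 ∧ ⋯ ∧ dx_n ∧ dξ_n` in a superform: in degree
`2n` it is the determinant in the ordered basis `dx_1, dξ_1, …, dx_n, dξ_n`; all other degrees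
contribute `0`. -/
def topCoeff (n : ℕ) : SForm n →ₗ[ℝ] ℝ :=
  ExteriorAlgebra.liftAlternating
    (Pi.single (n * 2)
      ((Pi.basisFun ℝ (Fin n × Fin 2)).det.domDomCongr finProdFinEquiv))

/-- The superintegral (Berezin integral) of a superform, normalized so that the integral of
`f dx_1 ∧ dξ_1 ∧ ⋯ ∧ dx_n ∧ dξ_n` is the Lebesgue integral of `f`. -/
def superIntegral {n : ℕ} (α : E n → SForm n) : ℝ := ∫ x, topCoeff n (α x)

/-- `IsMongeAmpere ψ μ`: the measure `μ` is the value at `ψ` of the continuous extension of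
`ψ ↦ (dd^# ψ)^n / n!` from smooth convex functions to convex functions. That is, `μ` is locally
finite, and whenever smooth convex functions `φ i` converge to `ψ` locally uniformly, the
superforms `(dd^# φ i)^n / n!` converge to `μ` weakly, tested on smooth functions `χ` with compact
support. -/
def IsMongeAmpere {n : ℕ} (ψ : E n → ℝ) (μ : Measure (E n)) : Prop :=
  IsLocallyFiniteMeasure μ ∧
    ∀ φ : ℕ → E n → ℝ,
      (∀ i, ContDiff ℝ ∞ (φ i) ∧ ConvexOn ℝ Set.univ (φ i)) →
      TendstoLocallyUniformly φ ψ atTop →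
      ∀ χ : E n → ℝ, ContDiff ℝ ∞ χ → HasCompactSupport χ →
        Tendsto
          (fun i => superIntegral fun x => χ x • ((n.factorial : ℝ)⁻¹ • ddSharp (φ i) x ^ n))
          atTop (𝓝 (∫ x, χ x ∂μ))

open Classical in
/-- The Monge-Ampère measure `MA(ψ) = (dd^# ψ)^n / n!`. -/
def MA {n : ℕ} (ψ : E n → ℝ) : Measure (E n) :=
  if h : ∃ μ, IsMongeAmpere ψ μ then h.choose else 0

/-- `ψ` is of linear growth: `ψ(x) ≤ A |x| + B` for some constants. -/
def LinearGrowth {n : ℕ} (ψ : E n → ℝ) : Prop :=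
  ∃ A B : ℝ, ∀ x, ψ x ≤ A * ‖x‖ + B

/-- The indicator function `ψ°(x) = lim_{t → ∞} ψ(t x) / t`. -/
def indicatorFn {n : ℕ} (ψ : E n → ℝ) (x : E n) : ℝ :=
  limUnder atTop (fun t : ℝ => ψ (t • x) / t)

/-- The support function `h_K(x) = sup_{y ∈ K} x ⋅ y` of a convex body (a nonempty compact
convex set). -/
def supportFn {n : ℕ} (K : ConvexBody (E n)) (x : E n) : ℝ :=
  sSup ((fun y => inner ℝ x y) '' (K : Set (E n)))

end SuperForms

end

namespace SuperForms

variable {n : ℕ} {φ ψ : E n → ℝ}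

/-! The measure `MA ψ` is identified with the Alexandrov measure of `ψ`: Lebesgue measure on the set
of all subgradients, pushed forward by the map taking a subgradient `p` to a point where `p`
supports `ψ`. This map is well defined almost everywhere, because two contact points of the same `p`
would both be the gradient at `p` of a Lipschitz conjugate function, which is differentiable almost
everywhere.

For smooth convex `φ`, the form `(dd^# φ)^n / n!` has coefficient `det (hessian φ)`, and the change
of variables `p = ∇φ(x)` turns this density into the Alexandrov measure
(`integral_mul_det_hessian`); the degenerate points have null image. Contact points are stable under
locally uniform convergence, so dominated convergence gives weak continuity
(`tendsto_integral_alexandrovMeasure`) and hence existence. Uniqueness holds because mollification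
supplies at least one smooth convex approximating sequence.

The total mass is then the volume of the set of subgradients. This set lies between the interior of
`K` and `K`, where `ψ° = h_K`, and the boundary of a convex body is null. For `ψ = h_K` the set is
`K` itself and every `p ∈ K` has the origin as a contact point, so all the mass sits at `0`. -/

/-! ### Top powers of `(1,1)`-forms in the exterior algebra. -/

theorem add_pow_succ_of_mul_self_eq_zero {A : Type*} [Ring A] {a s : A} (h : Commute a s)
    (ha : a * a = 0) (k : ℕ) :
    (a + s) ^ (k + 1) = s ^ (k + 1) + ((k + 1 : ℕ) : A) * (a * s ^ k) := by
  induction k with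
  | zero => simp [add_comm]
  | succ k ih =>
    have h1 : s * (a * s ^ k) = a * s ^ (k + 1) := by
      rw [← mul_assoc, ← h.eq, mul_assoc, pow_succ']
    have h2 : a * (a * s ^ k) = 0 := by rw [← mul_assoc, ha, zero_mul]
    have hc : ∀ x : A, x * ((k + 1 : ℕ) : A) = ((k + 1 : ℕ) : A) * x := fun x =>
      ((Nat.cast_commute (k + 1) x).eq).symm
    rw [pow_succ' (a + s), ih, mul_add, add_mul, add_mul, ← mul_assoc a, ← mul_assoc s, hc a, hc s,
      mul_assoc, mul_assoc, h1, h2, ← pow_succ' s]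
    push_cast
    noncomm_ring

/-- Only the squarefree monomial survives in the expansion, once for each ordering of the factors.
The vanishing of the next power is carried along because the inductive step needs it to kill the
term free of `w 0`. -/
theorem sum_pow_of_mul_self_eq_zero {A : Type*} [Ring A] (m : ℕ) (w : Fin m → A)
    (hc : ∀ i j, Commute (w i) (w j)) (hw : ∀ i, w i * w i = 0) :
    (∑ i, w i) ^ m = (m.factorial : A) * (List.ofFn w).prod ∧ (∑ i, w i) ^ (m + 1) = 0 := by
  induction m with
  | zero => simp
  | succ m ih =>
    obtain ⟨h1, h2⟩ := ih (fun i => w i.succ) (fun i j => hc _ _) (fun i => hw _)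
    have hcomm : Commute (w 0) (∑ i : Fin m, w i.succ) :=
      Commute.sum_right _ _ _ fun i _ => hc _ _
    rw [Fin.sum_univ_succ, add_pow_succ_of_mul_self_eq_zero hcomm (hw 0),
      add_pow_succ_of_mul_self_eq_zero hcomm (hw 0), h2, h1, pow_succ, h2]
    refine ⟨?_, by simp⟩
    rw [List.ofFn_succ, List.prod_cons, zero_add, Nat.factorial_succ, Nat.cast_mul, mul_assoc,
      ← mul_assoc (w 0), ← (Nat.cast_commute m.factorial (w 0)).eq, mul_assoc]

theorem commute_ι_mul_ι {M : Type*} [AddCommGroup M] [Module ℝ M] (a b c d : M) :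
    Commute (ExteriorAlgebra.ι ℝ a * ExteriorAlgebra.ι ℝ b)
      (ExteriorAlgebra.ι ℝ c * ExteriorAlgebra.ι ℝ d) := by
  have h : ∀ x y : M, ExteriorAlgebra.ι ℝ x * ExteriorAlgebra.ι ℝ y =
      - (ExteriorAlgebra.ι ℝ y * ExteriorAlgebra.ι ℝ x) := fun x y =>
    eq_neg_of_add_eq_zero_left (ExteriorAlgebra.ι_add_mul_swap x y)
  have h3 : ∀ z : M, Commute (ExteriorAlgebra.ι ℝ a * ExteriorAlgebra.ι ℝ b)
      (ExteriorAlgebra.ι ℝ z) := fun z => by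
    rw [Commute, SemiconjBy, mul_assoc, h b z, mul_neg, ← mul_assoc, h a z, neg_mul, neg_neg,
      mul_assoc]
  exact (h3 c).mul_right (h3 d)

theorem ι_mul_ι_mul_self {M : Type*} [AddCommGroup M] [Module ℝ M] (a b : M) :
    (ExteriorAlgebra.ι ℝ a * ExteriorAlgebra.ι ℝ b) *
      (ExteriorAlgebra.ι ℝ a * ExteriorAlgebra.ι ℝ b) = 0 := by
  have h := eq_neg_of_add_eq_zero_left (ExteriorAlgebra.ι_add_mul_swap (R := ℝ) b a)
  rw [mul_assoc, ← mul_assoc _ (ExteriorAlgebra.ι ℝ a), h, neg_mul, mul_neg, mul_assoc,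
    ExteriorAlgebra.ι_sq_zero, mul_zero, mul_zero, neg_zero]

/-- The top power of a `(1,1)`-form with constant coefficients is `n!` times the determinant. -/
theorem topCoeff_sum_pow {n : ℕ} (a : Matrix (Fin n) (Fin n) ℝ) :
    topCoeff n ((∑ j, ∑ k, a j k • (dx j * dxi k)) ^ n) = n.factorial * a.det := by
  let v : Fin n × Fin 2 → (Fin n × Fin 2 → ℝ) := fun q =>
    if q.2 = 0 then Pi.single (q.1, 0) 1 else ∑ k, a q.1 k • Pi.single (k, 1) 1
  -- Grouping by rows writes the form as a sum of `n` decomposable 2-forms, which commute and square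
  -- to zero.
  have hw : ∀ j, ∑ k, a j k • (dx j * dxi k) =
      ExteriorAlgebra.ι ℝ (v (j, 0)) * ExteriorAlgebra.ι ℝ (v (j, 1)) := fun j => by
    simp [v, dx, dxi, Finset.mul_sum, map_sum]
  have hlist : (List.ofFn fun j => ExteriorAlgebra.ι ℝ (v (j, 0)) *
      ExteriorAlgebra.ι ℝ (v (j, 1))).prod =
      ExteriorAlgebra.ιMulti ℝ (n * 2) (v ∘ finProdFinEquiv.symm) := by
    rw [ExteriorAlgebra.ιMulti_apply, List.ofFn_mul, List.prod_flatten, List.map_ofFn]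
    congr 2
    funext j
    have key : ∀ (i : Fin 2) (h : j.1 * 2 + i.1 < n * 2),
        finProdFinEquiv.symm ⟨j.1 * 2 + i.1, h⟩ = (j, i) := fun i h => by
      rw [Equiv.symm_apply_eq]; ext; simp [finProdFinEquiv]; ring
    have k0 := key 0
    have k1 := key 1 (by have := j.2; simp; omega)
    simp at k0 k1
    simp [k0, k1.1, k1.2]
  -- The `dx` and `dξ` generators do not mix, so the matrix is block diagonal with blocks `1` and
  -- `a`, up to transposition.
  have hdet : (Pi.basisFun ℝ (Fin n × Fin 2)).det v = a.det := by
    rw [Module.Basis.det_apply]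
    have : (Pi.basisFun ℝ (Fin n × Fin 2)).toMatrix v =
        (Matrix.blockDiagonal fun i : Fin 2 => if i = 0 then 1 else a).transpose := by
      ext p q
      obtain ⟨p1, p2⟩ := p
      obtain ⟨q1, q2⟩ := q
      fin_cases p2 <;> fin_cases q2 <;>
        simp [Module.Basis.toMatrix_apply, v, Matrix.blockDiagonal_apply, Pi.single_apply,
          Finset.sum_apply, Matrix.one_apply, eq_comm]
    rw [this]
    simp [Matrix.det_transpose, Matrix.det_blockDiagonal]
  simp_rw [hw]
  rw [(sum_pow_of_mul_self_eq_zero n _ (fun i j => commute_ι_mul_ι _ _ _ _)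
    (fun i => ι_mul_ι_mul_self _ _)).1, hlist, ← nsmul_eq_mul, map_nsmul, topCoeff,
    ExteriorAlgebra.liftAlternating_apply_ιMulti, Pi.single_eq_same,
    AlternatingMap.domDomCongr_apply, nsmul_eq_mul, ← hdet]
  congr 2
  funext q
  simp

theorem superIntegral_smul_ddSharp_pow {n : ℕ} (φ χ : E n → ℝ) :
    (superIntegral fun x => χ x • ((n.factorial : ℝ)⁻¹ • ddSharp φ x ^ n)) =
      ∫ x, χ x * (Matrix.of fun j k => pderiv j (pderiv k φ) x).det := by
  unfold superIntegral
  congr 1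
  funext x
  have h := topCoeff_sum_pow (Matrix.of fun j k => pderiv j (pderiv k φ) x)
  have h' : topCoeff n (ddSharp φ x ^ n) =
      n.factorial * (Matrix.of fun j k => pderiv j (pderiv k φ) x).det := h
  rw [map_smul, map_smul, h', smul_eq_mul, smul_eq_mul, inv_mul_cancel_left₀]
  exact_mod_cast n.factorial_ne_zero

/-! ### Subgradients, contact points and their almost everywhere uniqueness. -/

/-- `p` is a subgradient of `ψ` at `x`. -/
def IsSubgradient (ψ : E n → ℝ) (x p : E n) : Prop := ∀ y, ψ x + inner ℝ p (y - x) ≤ ψ y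

/-- The set of all subgradients of `ψ`. -/
def subgradientRange (ψ : E n → ℝ) : Set (E n) := {p | ∃ x, IsSubgradient ψ x p}

open Classical in
/-- A point at which `p` is a subgradient of `ψ`. -/
noncomputable def contactPoint (ψ : E n → ℝ) (p : E n) : E n :=
  if h : ∃ x, IsSubgradient ψ x p then h.choose else 0

theorem isSubgradient_contactPoint {p : E n} (hp : p ∈ subgradientRange ψ) :
    IsSubgradient ψ (contactPoint ψ p) p := by
  have hp' : ∃ x, IsSubgradient ψ x p := hp
  rw [contactPoint, dif_pos hp']
  exact hp'.choose_spec

theorem continuous_of_convexOn (hψ : ConvexOn ℝ Set.univ ψ) : Continuous ψ :=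
  continuousOn_univ.1 (hψ.continuousOn isOpen_univ)

/-- The conjugate function of the restriction of `ψ` to a ball. -/
noncomputable def ballConjugate (ψ : E n → ℝ) (R : ℝ) (p : E n) : ℝ :=
  sSup ((fun x => inner ℝ p x - ψ x) '' Metric.closedBall 0 R)

theorem le_ballConjugate (hψ : Continuous ψ) {R : ℝ} (p : E n) {x : E n} (hx : ‖x‖ ≤ R) :
    inner ℝ p x - ψ x ≤ ballConjugate ψ R p := by
  refine le_csSup ?_ ⟨x, by simpa using hx, rfl⟩
  exact ((isCompact_closedBall 0 R).image (by fun_prop)).bddAbove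

/-- A supremum of affine functions of slope at most `R`. Restricting to a ball keeps the conjugate
finite everywhere, so that Rademacher's theorem applies. -/
theorem lipschitzWith_ballConjugate (hψ : Continuous ψ) (R : NNReal) :
    LipschitzWith R (ballConjugate ψ R) := by
  refine LipschitzWith.of_le_add_mul R fun p q => ?_
  refine csSup_le ((Metric.nonempty_closedBall.2 R.2).image _) ?_
  rintro _ ⟨x, hx, rfl⟩
  have hx : ‖x‖ ≤ R := by simpa using hx
  have h1 := le_ballConjugate hψ q hx
  have h2 : inner ℝ (p - q) x ≤ ‖p - q‖ * ‖x‖ := real_inner_le_norm _ _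
  rw [inner_sub_left] at h2
  rw [dist_eq_norm]
  have h3 := mul_le_mul_of_nonneg_left hx (norm_nonneg (p - q))
  dsimp only
  linarith

/-- The affine minorant `q ↦ ⟨q, x⟩ - ψ x` touches the conjugate at `p`, by equality in Fenchel's
inequality, so their gradients agree there. -/
theorem gradient_ballConjugate (hψ : Continuous ψ) {R : ℝ} {x p : E n} (hx : ‖x‖ ≤ R)
    (hxp : IsSubgradient ψ x p) (hd : DifferentiableAt ℝ (ballConjugate ψ R) p) :
    gradient (ballConjugate ψ R) p = x := by
  have heq : ballConjugate ψ R p = inner ℝ p x - ψ x := by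
    refine le_antisymm (csSup_le ?_ ?_) (le_ballConjugate hψ p hx)
    · exact ⟨_, x, by simpa using hx, rfl⟩
    · rintro _ ⟨y, hy, rfl⟩
      have := hxp y
      rw [inner_sub_right] at this
      dsimp only
      linarith
  have hmin : IsLocalMin (fun q => ballConjugate ψ R q - inner ℝ x q) p := by
    refine Filter.Eventually.of_forall fun q => ?_
    have := le_ballConjugate hψ q hx
    simp only [heq]
    linarith [real_inner_comm x p, real_inner_comm x q]
  have hd2 : HasFDerivAt (fun q => ballConjugate ψ R q - inner ℝ x q)
      (fderiv ℝ (ballConjugate ψ R) p - innerSL ℝ x) p :=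
    hd.hasFDerivAt.sub (innerSL ℝ x).hasFDerivAt
  have h0 := sub_eq_zero.1 (hmin.hasFDerivAt_eq_zero hd2)
  rw [gradient, h0, LinearIsometryEquiv.symm_apply_eq]
  ext y
  simp

theorem ae_differentiableAt_ballConjugate (hψ : Continuous ψ) :
    ∀ᵐ p : E n, ∀ R : ℕ, DifferentiableAt ℝ (ballConjugate ψ R) p :=
  ae_all_iff.2 fun R => (lipschitzWith_ballConjugate hψ (R : NNReal)).ae_differentiableAt

/-- Almost every vector is a subgradient at one point at most. -/
theorem ae_isSubgradient_unique (hψ : Continuous ψ) :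
    ∀ᵐ p : E n, ∀ x y, IsSubgradient ψ x p → IsSubgradient ψ y p → x = y := by
  filter_upwards [ae_differentiableAt_ballConjugate hψ] with p hp x y hx hy
  obtain ⟨R, hR⟩ := exists_nat_ge (max ‖x‖ ‖y‖)
  rw [← gradient_ballConjugate hψ ((le_max_left _ _).trans hR) hx (hp R),
    gradient_ballConjugate hψ ((le_max_right _ _).trans hR) hy (hp R)]

theorem isSubgradient_of_tendsto {φ : ℕ → E n → ℝ} {u : ℕ → ℕ} {x : ℕ → E n} {p : ℕ → E n}
    {x₀ p₀ : E n} (hψ : Continuous ψ) (hφ : TendstoLocallyUniformly φ ψ atTop)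
    (hu : Tendsto u atTop atTop) (hx : Tendsto x atTop (𝓝 x₀)) (hp : Tendsto p atTop (𝓝 p₀))
    (h : ∀ i, IsSubgradient (φ (u i)) (x i) (p i)) : IsSubgradient ψ x₀ p₀ := by
  have hφ' : TendstoLocallyUniformly (fun i => φ (u i)) ψ atTop := fun s hs y => by
    obtain ⟨t, ht, h⟩ := hφ s hs y
    exact ⟨t, ht, hu.eventually h⟩
  intro y
  have h1 : Tendsto (fun i => φ (u i) (x i)) atTop (𝓝 (ψ x₀)) :=
    hφ'.tendsto_comp hψ.continuousAt hx
  have h2 : Tendsto (fun i => φ (u i) y) atTop (𝓝 (ψ y)) :=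
    hφ'.tendsto_comp hψ.continuousAt tendsto_const_nhds
  exact le_of_tendsto_of_tendsto' (h1.add (hp.inner (tendsto_const_nhds.sub hx))) h2
    fun i => h i y

/-- Bounded contact points have a convergent subsequence, and the subgradient inequality passes to
the limit. -/
theorem exists_isSubgradient_of_tendsto {φ : ℕ → E n → ℝ} {x : ℕ → E n} {p : ℕ → E n} {p₀ : E n}
    {R : ℝ} (hψ : Continuous ψ) (hφ : TendstoLocallyUniformly φ ψ atTop)
    (hx : ∃ᶠ i in atTop, ‖x i‖ ≤ R ∧ IsSubgradient (φ i) (x i) (p i))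
    (hp : Tendsto p atTop (𝓝 p₀)) : ∃ x₀, ‖x₀‖ ≤ R ∧ IsSubgradient ψ x₀ p₀ := by
  obtain ⟨u, hu, hxu⟩ := extraction_of_frequently_atTop hx
  obtain ⟨x₀, hx₀, v, hv, hlim⟩ := (isCompact_closedBall (0 : E n) R).tendsto_subseq
    (x := x ∘ u) fun i => by simpa using (hxu i).1
  exact ⟨x₀, by simpa using hx₀, isSubgradient_of_tendsto hψ hφ (hu.comp hv).tendsto_atTop hlim
    (hp.comp (hu.comp hv).tendsto_atTop) fun i => (hxu (v i)).2⟩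

theorem tendstoLocallyUniformly_const (ψ : E n → ℝ) :
    TendstoLocallyUniformly (fun _ : ℕ => ψ) ψ atTop := fun _ hs _ =>
  ⟨Set.univ, univ_mem, Filter.Eventually.of_forall fun _ _ _ => refl_mem_uniformity hs⟩

theorem isClosed_setOf_isSubgradient (hψ : Continuous ψ) (R : ℝ) :
    IsClosed {p : E n | ∃ x, ‖x‖ ≤ R ∧ IsSubgradient ψ x p} := by
  refine IsSeqClosed.isClosed fun p p₀ hp hlim => ?_
  choose x hx using hp
  exact exists_isSubgradient_of_tendsto hψ (tendstoLocallyUniformly_const ψ)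
    (Filter.Eventually.of_forall hx).frequently hlim

theorem subgradientRange_eq_iUnion (ψ : E n → ℝ) :
    subgradientRange ψ = ⋃ R : ℕ, {p : E n | ∃ x, ‖x‖ ≤ R ∧ IsSubgradient ψ x p} := by
  ext p
  simp only [subgradientRange, Set.mem_ofPred_eq, Set.mem_iUnion]
  constructor
  · rintro ⟨x, hx⟩
    obtain ⟨R, hR⟩ := exists_nat_ge ‖x‖
    exact ⟨R, x, hR, hx⟩
  · rintro ⟨R, x, -, hx⟩
    exact ⟨x, hx⟩

theorem measurableSet_subgradientRange (hψ : Continuous ψ) :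
    MeasurableSet (subgradientRange ψ) := by
  rw [subgradientRange_eq_iUnion]
  exact MeasurableSet.iUnion fun R => (isClosed_setOf_isSubgradient hψ R).measurableSet

/-- Almost everywhere the contact point is the limit of the gradients of `ballConjugate ψ R`, a
sequence constant once the ball contains the contact point. -/
theorem aemeasurable_contactPoint (hψ : Continuous ψ) :
    AEMeasurable (contactPoint ψ) (volume.restrict (subgradientRange ψ)) := by
  refine aemeasurable_of_tendsto_metrizable_ae (μ := volume.restrict (subgradientRange ψ)) atTop
    (f := fun R : ℕ => gradient (ballConjugate ψ R)) (fun R => ?_) ?_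
  · exact ((LinearIsometryEquiv.continuous _).measurable.comp
      (measurable_fderiv ℝ _)).aemeasurable
  · filter_upwards [ae_restrict_of_ae (ae_differentiableAt_ballConjugate hψ),
      ae_restrict_mem (measurableSet_subgradientRange hψ)] with p hp hpS
    have h := isSubgradient_contactPoint hpS
    refine tendsto_const_nhds.congr' ?_
    obtain ⟨R, hR⟩ := exists_nat_ge ‖contactPoint ψ p‖
    filter_upwards [eventually_ge_atTop R] with R' hR'
    exact (gradient_ballConjugate hψ (hR.trans (by exact_mod_cast hR')) h (hp R')).symm

/-! ### The Alexandrov measure. -/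

/-- The Alexandrov measure of `ψ`: the image of Lebesgue measure on the set of subgradients. -/
noncomputable def alexandrovMeasure (ψ : E n → ℝ) : Measure (E n) :=
  (volume.restrict (subgradientRange ψ)).map (contactPoint ψ)

theorem alexandrovMeasure_univ (hψ : Continuous ψ) :
    alexandrovMeasure ψ Set.univ = volume (subgradientRange ψ) := by
  rw [alexandrovMeasure, Measure.map_apply_of_aemeasurable (aemeasurable_contactPoint hψ)
    MeasurableSet.univ, Set.preimage_univ, Measure.restrict_apply_univ]

theorem integral_alexandrovMeasure (hψ : Continuous ψ) {χ : E n → ℝ} (hχ : Continuous χ) :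
    ∫ x, χ x ∂alexandrovMeasure ψ =
      ∫ p, (subgradientRange ψ).indicator (fun p => χ (contactPoint ψ p)) p := by
  rw [alexandrovMeasure, integral_map (aemeasurable_contactPoint hψ) hχ.aestronglyMeasurable,
    integral_indicator (measurableSet_subgradientRange hψ)]

/-- A unit step from `x` in the direction of `p` raises `ψ` by at least `‖p‖`. -/
theorem IsSubgradient.norm_le {x p : E n} {R C : ℝ} (h : IsSubgradient ψ x p) (hx : ‖x‖ ≤ R)
    (hC : ∀ y, ‖y‖ ≤ R + 1 → |ψ y| ≤ C) : ‖p‖ ≤ 2 * C := by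
  have hx1 := abs_le.1 (hC x (hx.trans (by linarith)))
  rcases eq_or_ne p 0 with rfl | hp
  · rw [norm_zero]; linarith
  have hp' : ‖p‖ ≠ 0 := norm_ne_zero_iff.2 hp
  have hu : ‖‖p‖⁻¹ • p‖ = 1 := by rw [norm_smul, norm_inv, norm_norm, inv_mul_cancel₀ hp']
  have hy := abs_le.1 (hC (x + ‖p‖⁻¹ • p) ((norm_add_le _ _).trans (by rw [hu]; linarith)))
  have h1 := h (x + ‖p‖⁻¹ • p)
  rw [add_sub_cancel_left, inner_smul_right, real_inner_self_eq_norm_mul_norm,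
    inv_mul_cancel_left₀ hp'] at h1
  linarith

theorem exists_abs_le_closedBall (hψ : Continuous ψ) (R : ℝ) :
    ∃ C, ∀ y, ‖y‖ ≤ R → |ψ y| ≤ C := by
  obtain ⟨C, hC⟩ := (isCompact_closedBall (0 : E n) R).exists_bound_of_continuousOn
    hψ.continuousOn
  exact ⟨C, fun y hy => hC y (by simpa using hy)⟩

theorem isLocallyFiniteMeasure_alexandrovMeasure (hψ : Continuous ψ) :
    IsLocallyFiniteMeasure (alexandrovMeasure ψ) := by
  refine ⟨fun x => ⟨Metric.closedBall 0 (‖x‖ + 1), ?_, ?_⟩⟩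
  · exact mem_of_superset (Metric.ball_mem_nhds x one_pos) fun y hy => by
      rw [mem_ball_iff_norm] at hy
      rw [mem_closedBall_zero_iff]
      linarith [norm_le_norm_add_norm_sub' y x]
  · obtain ⟨C, hC⟩ := exists_abs_le_closedBall hψ (‖x‖ + 1 + 1)
    rw [alexandrovMeasure, Measure.map_apply_of_aemeasurable (aemeasurable_contactPoint hψ)
      Metric.isClosed_closedBall.measurableSet,
      Measure.restrict_apply' (measurableSet_subgradientRange hψ)]
    refine (measure_mono (t := Metric.closedBall 0 (2 * C)) ?_).trans_lt
      (isCompact_closedBall _ _).measure_lt_top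
    rintro p ⟨hp, hpS⟩
    rw [mem_closedBall_zero_iff]
    exact (isSubgradient_contactPoint hpS).norm_le (by simpa using hp) hC

/-! ### Stability of contact points and weak continuity. -/

theorem isSubgradient_iff {x p : E n} :
    IsSubgradient ψ x p ↔ ∀ y, ψ x - inner ℝ p x ≤ ψ y - inner ℝ p y := by
  refine forall_congr' fun y => ?_
  rw [inner_sub_right]
  constructor <;> intro h <;> linarith

theorem convexOn_sub_inner (hψ : ConvexOn ℝ Set.univ ψ) (p : E n) :
    ConvexOn ℝ Set.univ fun x => ψ x - inner ℝ p x :=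
  hψ.sub ((innerSL ℝ p).toLinearMap.concaveOn convex_univ)

/-- If `y` were on or beyond the sphere, the segment from `x` to `y` would cross it at a point where
convexity forces a value at most `g x`. -/
theorem norm_sub_lt_of_le_of_lt_sphere {g : E n → ℝ} (hg : ConvexOn ℝ Set.univ g) {x : E n}
    {r : ℝ} (hr : 0 < r) (hs : ∀ y, ‖y - x‖ = r → g x < g y) {y : E n} (hy : g y ≤ g x) :
    ‖y - x‖ < r := by
  by_contra! hlt
  have hpos : 0 < ‖y - x‖ := hr.trans_le hlt
  have ht0 : 0 ≤ r / ‖y - x‖ := by positivity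
  have ht1 : r / ‖y - x‖ ≤ 1 := (div_le_one hpos).2 hlt
  have hw := hs ((1 - r / ‖y - x‖) • x + (r / ‖y - x‖) • y) (by
    have : (1 - r / ‖y - x‖) • x + (r / ‖y - x‖) • y - x = (r / ‖y - x‖) • (y - x) := by module
    rw [this, norm_smul, Real.norm_of_nonneg ht0, div_mul_cancel₀ _ hpos.ne'])
  have hc := hg.2 (Set.mem_univ x) (Set.mem_univ y) (sub_nonneg.2 ht1) ht0 (sub_add_cancel _ _)
  simp only [smul_eq_mul] at hc
  nlinarith

theorem exists_forall_le_of_lt_sphere {g : E n → ℝ} (hg : ConvexOn ℝ Set.univ g) {x : E n}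
    {r : ℝ} (hr : 0 < r) (hs : ∀ y, ‖y - x‖ = r → g x < g y) : ∃ z, ∀ y, g z ≤ g y := by
  obtain ⟨z, -, hz⟩ := (isCompact_closedBall x r).exists_isMinOn
    (Metric.nonempty_closedBall.2 hr.le) (continuous_of_convexOn hg).continuousOn
  refine ⟨z, fun y => ?_⟩
  rcases le_total (g y) (g x) with h | h
  · exact hz (mem_closedBall_iff_norm.2 (norm_sub_lt_of_le_of_lt_sphere hg hr hs h).le)
  · exact (hz (Metric.mem_closedBall_self hr.le)).trans h

/-- The point `x` is the strict minimum of `ψ - ⟨p, ·⟩`. A uniform gap on a small sphere around it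
survives a small perturbation, which traps all minima of the perturbed convex function inside. -/
theorem tendsto_contactPoint {φ : ℕ → E n → ℝ} (hψ : Continuous ψ)
    (hφc : ∀ i, ConvexOn ℝ Set.univ (φ i)) (hφ : TendstoLocallyUniformly φ ψ atTop) {x p : E n}
    (hx : IsSubgradient ψ x p) (hp : ∀ y, IsSubgradient ψ y p → y = x) :
    (∀ᶠ i in atTop, p ∈ subgradientRange (φ i)) ∧
      Tendsto (fun i => contactPoint (φ i) p) atTop (𝓝 x) := by
  have key : ∀ r > 0, ∀ᶠ i in atTop, p ∈ subgradientRange (φ i) ∧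
      ‖contactPoint (φ i) p - x‖ < r := fun r hr => by
    have hx' := isSubgradient_iff.1 hx
    have hδ : ∃ δ > 0, ∀ y, ‖y - x‖ = r →
        ψ x - inner ℝ p x + 2 * δ ≤ ψ y - inner ℝ p y := by
      -- The sphere is empty when `n = 0`.
      rcases (Metric.sphere x r).eq_empty_or_nonempty with h | h
      · refine ⟨1, one_pos, fun y hy => ?_⟩
        exact (Set.eq_empty_iff_forall_notMem.1 h y (mem_sphere_iff_norm.2 hy)).elim
      · obtain ⟨y₀, hy₀, hmin⟩ := (isCompact_sphere x r).exists_isMinOn h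
          (f := fun y => ψ y - inner ℝ p y) (by fun_prop)
        refine ⟨((ψ y₀ - inner ℝ p y₀) - (ψ x - inner ℝ p x)) / 2, ?_, fun y hy => ?_⟩
        · by_contra! hle
          have : y₀ = x := hp y₀ (isSubgradient_iff.2 fun y => by linarith [hx' y])
          rw [mem_sphere_iff_norm, this, sub_self, norm_zero] at hy₀
          exact hr.ne hy₀
        · have : ψ y₀ - inner ℝ p y₀ ≤ ψ y - inner ℝ p y := hmin (mem_sphere_iff_norm.2 hy)
          linarith
    obtain ⟨δ, hδ, hsph⟩ := hδ
    have hunif := tendstoLocallyUniformly_iff_forall_isCompact.1 hφ _ (isCompact_closedBall x r)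
    filter_upwards [Metric.tendstoUniformlyOn_iff.1 hunif δ hδ] with i hi
    simp only [Real.dist_eq, abs_lt, mem_closedBall_iff_norm] at hi
    have hs : ∀ y, ‖y - x‖ = r → φ i x - inner ℝ p x < φ i y - inner ℝ p y := fun y hy => by
      have h1 := hi y hy.le
      have h2 := hi x (by simpa using hr.le)
      linarith [hsph y hy]
    have hgc := convexOn_sub_inner (hφc i) p
    obtain ⟨z, hz⟩ := exists_forall_le_of_lt_sphere hgc hr hs
    have hS : p ∈ subgradientRange (φ i) := ⟨z, isSubgradient_iff.2 hz⟩
    exact ⟨hS, norm_sub_lt_of_le_of_lt_sphere hgc hr hs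
      (isSubgradient_iff.1 (isSubgradient_contactPoint hS) x)⟩
  refine ⟨(key 1 one_pos).mono fun i hi => hi.1, Metric.tendsto_nhds.2 fun r hr => ?_⟩
  exact (key r hr).mono fun i hi => by rw [dist_eq_norm]; exact hi.2

theorem tendsto_indicator_contactPoint {φ : ℕ → E n → ℝ} (hψ : Continuous ψ)
    (hφc : ∀ i, ConvexOn ℝ Set.univ (φ i)) (hφ : TendstoLocallyUniformly φ ψ atTop)
    {χ : E n → ℝ} (hχ : Continuous χ) (hχc : HasCompactSupport χ) {p : E n}
    (hp : ∀ x y, IsSubgradient ψ x p → IsSubgradient ψ y p → x = y) :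
    Tendsto (fun i => (subgradientRange (φ i)).indicator (fun p => χ (contactPoint (φ i) p)) p)
      atTop (𝓝 ((subgradientRange ψ).indicator (fun p => χ (contactPoint ψ p)) p)) := by
  by_cases hS : p ∈ subgradientRange ψ
  · have hx := isSubgradient_contactPoint hS
    obtain ⟨h1, h2⟩ := tendsto_contactPoint hψ hφc hφ hx fun y hy => hp _ _ hy hx
    rw [Set.indicator_of_mem hS]
    refine (hχ.continuousAt.tendsto.comp h2).congr' ?_
    filter_upwards [h1] with i hi
    rw [Set.indicator_of_mem hi, Function.comp_apply]
  · rw [Set.indicator_of_notMem hS]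
    obtain ⟨R, hR⟩ := hχc.isCompact.isBounded.exists_norm_le
    refine tendsto_const_nhds.congr' ?_
    -- Otherwise `χ` is nonzero at infinitely many of the contact points, which therefore lie in a
    -- fixed ball and accumulate at a contact point of `ψ`.
    by_contra hne
    refine hS ?_
    have hf : ∃ᶠ i in atTop, ‖contactPoint (φ i) p‖ ≤ R ∧
        IsSubgradient (φ i) (contactPoint (φ i) p) p := (not_eventually.1 hne).mono fun i hi => by
      have hi' := Set.mem_of_indicator_ne_zero (Ne.symm hi)
      simp only [Set.indicator_of_mem hi'] at hi
      exact ⟨hR _ (subset_tsupport χ (Ne.symm hi)), isSubgradient_contactPoint hi'⟩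
    obtain ⟨x, -, hx⟩ := exists_isSubgradient_of_tendsto hψ hφ hf tendsto_const_nhds
    exact ⟨x, hx⟩

/-- The Alexandrov measure is continuous under locally uniform convergence. -/
theorem tendsto_integral_alexandrovMeasure {φ : ℕ → E n → ℝ} (hψ : Continuous ψ)
    (hφc : ∀ i, ConvexOn ℝ Set.univ (φ i)) (hφ : TendstoLocallyUniformly φ ψ atTop)
    {χ : E n → ℝ} (hχ : Continuous χ) (hχc : HasCompactSupport χ) :
    Tendsto (fun i => ∫ x, χ x ∂alexandrovMeasure (φ i)) atTop
      (𝓝 (∫ x, χ x ∂alexandrovMeasure ψ)) := by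
  simp only [integral_alexandrovMeasure (continuous_of_convexOn (hφc _)) hχ,
    integral_alexandrovMeasure hψ hχ]
  obtain ⟨R, hR⟩ := hχc.isCompact.isBounded.exists_norm_le
  obtain ⟨C, hC⟩ := exists_abs_le_closedBall hψ (R + 1)
  obtain ⟨D, hD⟩ := hχ.bounded_above_of_compact_support hχc
  have hunif := tendstoLocallyUniformly_iff_forall_isCompact.1 hφ _
    (isCompact_closedBall 0 (R + 1))
  -- Eventually `|φ i| ≤ C + 1` on the ball of radius `R + 1`, so subgradients with contact point in
  -- the support of `χ` have norm at most `2 * (C + 1)`.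
  refine tendsto_integral_filter_of_dominated_convergence
    ((Metric.closedBall 0 (2 * (C + 1))).indicator fun _ => D) ?_ ?_ ?_ ?_
  · refine Filter.Eventually.of_forall fun i => ?_
    have hc := continuous_of_convexOn (hφc i)
    rw [aestronglyMeasurable_indicator_iff (measurableSet_subgradientRange hc)]
    exact (hχ.measurable.comp_aemeasurable (aemeasurable_contactPoint hc)).aestronglyMeasurable
  · filter_upwards [Metric.tendstoUniformlyOn_iff.1 hunif 1 one_pos] with i hi
    refine Filter.Eventually.of_forall fun p => ?_
    simp only [Real.dist_eq, abs_lt, mem_closedBall_zero_iff] at hi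
    have hD0 : 0 ≤ D := (norm_nonneg _).trans (hD 0)
    by_cases h0 : (subgradientRange (φ i)).indicator (fun p => χ (contactPoint (φ i) p)) p = 0
    · rw [h0, norm_zero]
      exact Set.indicator_nonneg (fun _ _ => hD0) _
    · have hi' := Set.mem_of_indicator_ne_zero h0
      rw [Set.indicator_of_mem hi'] at h0 ⊢
      rw [Set.indicator_of_mem]
      · exact hD _
      · rw [mem_closedBall_zero_iff]
        refine (isSubgradient_contactPoint hi').norm_le (hR _ (subset_tsupport χ h0))
          fun y hy => ?_
        have h1 := hi y hy
        have h2 := abs_le.1 (hC y hy)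
        exact abs_le.2 ⟨by linarith, by linarith⟩
  · exact (integrable_indicator_iff Metric.isClosed_closedBall.measurableSet).2
      (integrableOn_const (isCompact_closedBall _ _).measure_ne_top)
  · filter_upwards [ae_isSubgradient_unique hψ] with p hp
    exact tendsto_indicator_contactPoint hψ hφc hφ hχ hχc hp

/-! ### The smooth case: Hessian determinant and change of variables. -/

/-- The gradient map of a function, given by its partial derivatives. -/
noncomputable def gradientMap (φ : E n → ℝ) (x : E n) : E n :=
  WithLp.toLp 2 fun k => pderiv k φ x

/-- The Hessian matrix. -/
noncomputable def hessian (φ : E n → ℝ) (x : E n) : Matrix (Fin n) (Fin n) ℝ :=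
  Matrix.of fun j k => pderiv j (pderiv k φ) x

theorem map_eq_sum_mul_single (L : E n →L[ℝ] ℝ) (v : E n) :
    L v = ∑ k, L (EuclideanSpace.single k 1) * v k := by
  have h : v = ∑ k, v k • EuclideanSpace.single k (1 : ℝ) := by
    ext i
    simp [Finset.sum_apply, Pi.single_apply]
  conv_lhs => rw [h]
  simp [mul_comm]

theorem inner_gradientMap (φ : E n → ℝ) (x v : E n) :
    inner ℝ (gradientMap φ x) v = fderiv ℝ φ x v := by
  rw [map_eq_sum_mul_single, PiLp.inner_apply]
  simp [gradientMap, pderiv, mul_comm]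

theorem contDiff_gradientMap (hφ : ContDiff ℝ ∞ φ) : ContDiff ℝ ∞ (gradientMap φ) := by
  rw [contDiff_euclidean]
  intro k
  exact (hφ.fderiv_right (m := ∞) (by simp)).clm_apply contDiff_const

theorem fderiv_gradientMap_apply (hφ : ContDiff ℝ ∞ φ) (x v : E n) (k : Fin n) :
    fderiv ℝ (gradientMap φ) x v k = fderiv ℝ (pderiv k φ) x v := by
  have h := ((contDiff_gradientMap hφ).differentiable (by simp) x).hasFDerivAt
  have h2 : HasFDerivAt (pderiv k φ) ((EuclideanSpace.proj k).comp
      (fderiv ℝ (gradientMap φ) x)) x :=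
    (EuclideanSpace.proj k : E n →L[ℝ] ℝ).hasFDerivAt.comp x h
  rw [h2.fderiv]
  rfl

theorem fderiv_gradientMap_apply_eq_mulVec (hφ : ContDiff ℝ ∞ φ) (x v : E n) (k : Fin n) :
    fderiv ℝ (gradientMap φ) x v k = ((hessian φ x).transpose.mulVec v) k := by
  rw [fderiv_gradientMap_apply hφ, map_eq_sum_mul_single]
  rfl

theorem det_fderiv_gradientMap (hφ : ContDiff ℝ ∞ φ) (x : E n) :
    (fderiv ℝ (gradientMap φ) x).det = (hessian φ x).det := by
  rw [ContinuousLinearMap.det,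
    ← LinearMap.det_toMatrix (EuclideanSpace.basisFun (Fin n) ℝ).toBasis,
    ← Matrix.det_transpose (hessian φ x)]
  congr 1
  ext i j
  rw [LinearMap.toMatrix_apply]
  simp [fderiv_gradientMap_apply hφ, hessian, pderiv]

theorem isSubgradient_gradientMap (hφ : ContDiff ℝ ∞ φ) (hc : ConvexOn ℝ Set.univ φ) (x : E n) :
    IsSubgradient φ x (gradientMap φ x) := by
  intro y
  rw [inner_gradientMap]
  have hl : ConvexOn ℝ Set.univ (φ ∘ AffineMap.lineMap (k := ℝ) x y) :=
    hc.comp_affineMap (AffineMap.lineMap x y)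
  have hφ' : HasFDerivAt φ (fderiv ℝ φ x) (AffineMap.lineMap x y (0 : ℝ)) := by
    rw [AffineMap.lineMap_apply_zero]
    exact (hφ.differentiable (by simp) x).hasFDerivAt
  have hd := hφ'.comp_hasDerivAt (0 : ℝ) AffineMap.hasDerivAt_lineMap
  have := hl.le_slope_of_hasDerivAt (Set.mem_univ _) (Set.mem_univ _) zero_lt_one hd
  simp [slope_def_field] at this
  rw [map_sub]
  linarith

theorem IsSubgradient.eq_gradientMap (hφ : ContDiff ℝ ∞ φ) {x p : E n}
    (h : IsSubgradient φ x p) : gradientMap φ x = p := by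
  have hmin : IsLocalMin (fun y => φ y - inner ℝ p y) x :=
    Filter.Eventually.of_forall (isSubgradient_iff.1 h)
  have hd : HasFDerivAt (fun y => φ y - inner ℝ p y) (fderiv ℝ φ x - innerSL ℝ p) x :=
    (hφ.differentiable (by simp) x).hasFDerivAt.sub (innerSL ℝ p).hasFDerivAt
  have h0 := sub_eq_zero.1 (hmin.hasFDerivAt_eq_zero hd)
  refine ext_inner_right ℝ fun v => ?_
  rw [inner_gradientMap, h0, innerSL_apply_apply]

theorem isHermitian_hessian (hφ : ContDiff ℝ ∞ φ) (x : E n) : (hessian φ x).IsHermitian := by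
  have hd : DifferentiableAt ℝ (fderiv ℝ φ) x :=
    (hφ.fderiv_right (m := ∞) (by simp)).differentiable (by simp) x
  have key : ∀ j k, hessian φ x j k =
      fderiv ℝ (fderiv ℝ φ) x (EuclideanSpace.single j 1) (EuclideanSpace.single k 1) :=
    fun j k => by
      have h := hd.hasFDerivAt.clm_apply
        (hasFDerivAt_const (EuclideanSpace.single k (1 : ℝ)) x)
      have h' : fderiv ℝ (pderiv k φ) x = _ := h.fderiv
      simp [hessian, pderiv.eq_def j, h']
  ext j k
  rw [Matrix.conjTranspose_apply, star_trivial, key, key]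
  exact hφ.contDiffAt.isSymmSndFDerivAt (by
    rw [minSmoothness_of_isRCLikeNormedField]
    exact WithTop.coe_le_coe.2 (le_top : (2 : ℕ∞) ≤ ⊤)) _ _

theorem posSemidef_hessian (hφ : ContDiff ℝ ∞ φ) (hc : ConvexOn ℝ Set.univ φ) (x : E n) :
    (hessian φ x).PosSemidef := by
  refine .of_dotProduct_mulVec_nonneg (isHermitian_hessian hφ x) fun v => ?_
  let w : E n := WithLp.toLp 2 v
  have hmono : Monotone fun t : ℝ => inner ℝ (gradientMap φ (x + t • w)) w := fun s t hst => by
    have h1 := isSubgradient_gradientMap hφ hc (x + s • w) (x + t • w)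
    have h2 := isSubgradient_gradientMap hφ hc (x + t • w) (x + s • w)
    have e1 : x + t • w - (x + s • w) = (t - s) • w := by module
    have e2 : x + s • w - (x + t • w) = -((t - s) • w) := by module
    rw [e1, inner_smul_right] at h1
    rw [e2, inner_neg_right, inner_smul_right] at h2
    rcases hst.eq_or_lt with rfl | hlt
    · exact le_rfl
    · exact le_of_mul_le_mul_left (by linarith) (sub_pos.2 hlt)
  have hl : HasDerivAt (fun t : ℝ => x + t • w) w 0 := by
    simpa using ((hasDerivAt_id (0 : ℝ)).smul_const w).const_add x
  have hF : HasFDerivAt (gradientMap φ) (fderiv ℝ (gradientMap φ) x) (x + (0 : ℝ) • w) := by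
    rw [zero_smul, add_zero]
    exact ((contDiff_gradientMap hφ).differentiable (by simp) x).hasFDerivAt
  have hd := (hF.comp_hasDerivAt (0 : ℝ) hl).inner ℝ (hasDerivAt_const (0 : ℝ) w)
  have h0 := hmono.deriv_nonneg (x := 0)
  have hd' : deriv (fun t : ℝ => inner ℝ (gradientMap φ (x + t • w)) w) 0 = _ := hd.deriv
  rw [hd', inner_zero_right, zero_add, PiLp.inner_apply] at h0
  simp only [fderiv_gradientMap_apply_eq_mulVec hφ] at h0
  have hT : (hessian φ x).transpose = hessian φ x := by
    rw [← Matrix.conjTranspose_eq_transpose_of_trivial]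
    exact (isHermitian_hessian hφ x).eq
  rw [hT] at h0
  simpa [dotProduct, w] using h0

/-- Both points minimise `φ - ⟨p, ·⟩` for the common gradient `p`, hence so does the whole segment
between them. The gradient is thus constant along it, and its invertible derivative at `x`
annihilates `y - x`. -/
theorem eq_of_gradientMap_eq (hφ : ContDiff ℝ ∞ φ) (hc : ConvexOn ℝ Set.univ φ) {x y : E n}
    (hx : (fderiv ℝ (gradientMap φ) x).det ≠ 0) (hxy : gradientMap φ x = gradientMap φ y) :
    x = y := by
  have hsx := isSubgradient_iff.1 (isSubgradient_gradientMap hφ hc x)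
  have hsy := isSubgradient_iff.1 (isSubgradient_gradientMap hφ hc y)
  rw [← hxy] at hsy
  have hconst : ∀ t ∈ Set.Icc (0 : ℝ) 1,
      gradientMap φ (AffineMap.lineMap x y t) = gradientMap φ x := fun t ht => by
    refine IsSubgradient.eq_gradientMap hφ (isSubgradient_iff.2 fun z => ?_)
    have h1 := (convexOn_sub_inner hc (gradientMap φ x)).2 (Set.mem_univ x) (Set.mem_univ y)
      (sub_nonneg.2 ht.2) ht.1 (sub_add_cancel _ _)
    rw [← AffineMap.lineMap_apply_module] at h1
    simp only [smul_eq_mul] at h1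
    have h2 := mul_le_mul_of_nonneg_left (hsx z) (sub_nonneg.2 ht.2)
    have h3 := mul_le_mul_of_nonneg_left (hsy z) ht.1
    linarith
  have hF : HasFDerivAt (gradientMap φ) (fderiv ℝ (gradientMap φ) x)
      (AffineMap.lineMap x y (0 : ℝ)) := by
    rw [AffineMap.lineMap_apply_zero]
    exact ((contDiff_gradientMap hφ).differentiable (by simp) x).hasFDerivAt
  have hd := (hF.comp_hasDerivAt (0 : ℝ) AffineMap.hasDerivAt_lineMap).hasDerivWithinAt
    (s := Set.Icc 0 1)
  have hd0 : HasDerivWithinAt (gradientMap φ ∘ AffineMap.lineMap (k := ℝ) x y) 0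
      (Set.Icc 0 1) 0 :=
    (hasDerivWithinAt_const (0 : ℝ) (Set.Icc 0 1) (gradientMap φ x)).congr hconst
      (hconst 0 (by simp))
  have h0 := (uniqueDiffOn_Icc zero_lt_one 0 (by simp)).eq_deriv _ hd hd0
  have hinj : Function.Injective (fderiv ℝ (gradientMap φ) x) :=
    (LinearEquiv.ofIsUnitDet (f := (fderiv ℝ (gradientMap φ) x : E n →ₗ[ℝ] E n))
      (v := (EuclideanSpace.basisFun (Fin n) ℝ).toBasis)
      (v' := (EuclideanSpace.basisFun (Fin n) ℝ).toBasis)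
      (by rw [LinearMap.det_toMatrix]; exact isUnit_iff_ne_zero.2 hx)).injective
  exact (sub_eq_zero.1 (hinj (h0.trans (map_zero _).symm))).symm

theorem subgradientRange_eq_range (hφ : ContDiff ℝ ∞ φ) (hc : ConvexOn ℝ Set.univ φ) :
    subgradientRange φ = Set.range (gradientMap φ) := by
  ext p
  constructor
  · rintro ⟨x, hx⟩
    exact ⟨x, hx.eq_gradientMap hφ⟩
  · rintro ⟨x, rfl⟩
    exact ⟨x, isSubgradient_gradientMap hφ hc x⟩

/-- For a smooth convex function the Alexandrov measure has the Hessian determinant as density. -/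
theorem integral_mul_det_hessian (hφ : ContDiff ℝ ∞ φ) (hc : ConvexOn ℝ Set.univ φ)
    {χ : E n → ℝ} (hχ : Continuous χ) :
    ∫ x, χ x * (hessian φ x).det = ∫ x, χ x ∂alexandrovMeasure φ := by
  set F' := fderiv ℝ (gradientMap φ) with hF'
  set U : Set (E n) := {x | (F' x).det ≠ 0} with hU
  have hcont : Continuous fun x => (F' x).det :=
    ContinuousLinearMap.continuous_det.comp
      ((contDiff_gradientMap hφ).continuous_fderiv (by simp))
  have hUm : MeasurableSet U := (isOpen_ne_fun hcont continuous_const).measurableSet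
  have hder : ∀ (s : Set (E n)), ∀ x ∈ s, HasFDerivWithinAt (gradientMap φ) (F' x) s x :=
    fun s x _ => ((contDiff_gradientMap hφ).differentiable (by simp) x).hasFDerivAt.hasFDerivWithinAt
  have hcp : ∀ x ∈ U, contactPoint φ (gradientMap φ x) = x := fun x hx =>
    (eq_of_gradientMap_eq hφ hc hx ((isSubgradient_contactPoint
      ⟨x, isSubgradient_gradientMap hφ hc x⟩).eq_gradientMap hφ).symm).symm
  -- Sard's lemma: the critical points of the gradient map have null image.
  have hS : gradientMap φ '' U =ᵐ[volume] subgradientRange φ := by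
    rw [subgradientRange_eq_range hφ hc, ← Set.image_univ, ← Set.union_compl_self U,
      Set.image_union]
    refine (union_ae_eq_left_of_ae_eq_empty (ae_eq_empty.2 ?_)).symm
    exact addHaar_image_eq_zero_of_det_fderivWithin_eq_zero volume (hder _) fun x hx =>
      not_not.1 hx
  rw [integral_alexandrovMeasure (continuous_of_convexOn hc) hχ,
    integral_indicator (measurableSet_subgradientRange (continuous_of_convexOn hc)),
    ← setIntegral_congr_set hS, integral_image_eq_integral_abs_det_fderiv_smul volume hUm (hder U)
      fun x hx y _ hxy => eq_of_gradientMap_eq hφ hc hx hxy,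
    ← setIntegral_eq_integral_of_forall_compl_eq_zero (s := U)]
  · refine setIntegral_congr_fun hUm fun x hx => ?_
    rw [hcp x hx, hF', det_fderiv_gradientMap hφ,
      abs_of_nonneg (posSemidef_hessian hφ hc x).det_nonneg, smul_eq_mul, mul_comm]
  · intro x hx
    rw [← det_fderiv_gradientMap hφ, not_not.1 hx, mul_zero]

theorem superIntegral_eq_integral_alexandrovMeasure (hφ : ContDiff ℝ ∞ φ)
    (hc : ConvexOn ℝ Set.univ φ) {χ : E n → ℝ} (hχ : Continuous χ) :
    (superIntegral fun x => χ x • ((n.factorial : ℝ)⁻¹ • ddSharp φ x ^ n)) =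
      ∫ x, χ x ∂alexandrovMeasure φ := by
  rw [superIntegral_smul_ddSharp_pow]
  exact integral_mul_det_hessian hφ hc hχ

theorem isMongeAmpere_alexandrovMeasure {ψ : E n → ℝ} (hψ : ConvexOn ℝ Set.univ ψ) :
    IsMongeAmpere ψ (alexandrovMeasure ψ) := by
  have hc := continuous_of_convexOn hψ
  refine ⟨isLocallyFiniteMeasure_alexandrovMeasure hc, fun φ hφ hlim χ hχ hχc => ?_⟩
  simp only [superIntegral_eq_integral_alexandrovMeasure (hφ _).1 (hφ _).2 hχ.continuous]
  exact tendsto_integral_alexandrovMeasure hc (fun i => (hφ i).2) hlim hχ.continuous hχc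

/-! ### Mollification and uniqueness of the Monge-Ampère measure. -/

open scoped Convolution in
theorem convexOn_convolution {ρ : E n → ℝ} (hρ : Continuous ρ) (hρc : HasCompactSupport ρ)
    (hρ0 : ∀ x, 0 ≤ ρ x) (hψ : ConvexOn ℝ Set.univ ψ) :
    ConvexOn ℝ Set.univ (ρ ⋆[ContinuousLinearMap.lsmul ℝ ℝ, volume] ψ) := by
  have hc := continuous_of_convexOn hψ
  have hint : ∀ x, Integrable fun t => ρ t * ψ (x - t) := fun x =>
    (hρ.mul (by fun_prop)).integrable_of_hasCompactSupport hρc.mul_right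
  refine ⟨convex_univ, fun x _ y _ a b ha hb hab => ?_⟩
  simp only [convolution, ContinuousLinearMap.lsmul_apply, smul_eq_mul]
  rw [← integral_const_mul, ← integral_const_mul,
    ← integral_add ((hint x).const_mul a) ((hint y).const_mul b)]
  refine integral_mono (hint _) (((hint x).const_mul a).add ((hint y).const_mul b)) fun t => ?_
  have h := hψ.2 (Set.mem_univ (x - t)) (Set.mem_univ (y - t)) ha hb hab
  have e : a • (x - t) + b • (y - t) = a • x + b • y - t := by
    rw [smul_sub, smul_sub, sub_add_sub_comm, ← add_smul, hab, one_smul]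
  rw [e] at h
  have := mul_le_mul_of_nonneg_left h (hρ0 t)
  simp only [smul_eq_mul] at this
  dsimp only
  linarith

open scoped Convolution in
/-- Convex functions are locally uniform limits of smooth convex functions. -/
theorem exists_contDiff_convexOn_tendsto (hψ : ConvexOn ℝ Set.univ ψ) :
    ∃ φ : ℕ → E n → ℝ, (∀ i, ContDiff ℝ ∞ (φ i) ∧ ConvexOn ℝ Set.univ (φ i)) ∧
      TendstoLocallyUniformly φ ψ atTop := by
  have hc := continuous_of_convexOn hψ
  let b : ℕ → ContDiffBump (0 : E n) := fun i =>
    ⟨1 / ((i : ℝ) + 1) / 2, 1 / ((i : ℝ) + 1), by positivity, half_lt_self (by positivity)⟩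
  refine ⟨fun i => (b i).normed volume ⋆[ContinuousLinearMap.lsmul ℝ ℝ, volume] ψ,
    fun i => ⟨?_, ?_⟩, ?_⟩
  · exact (b i).hasCompactSupport_normed.contDiff_convolution_left _ (b i).contDiff_normed
      hc.locallyIntegrable
  · exact convexOn_convolution (b i).continuous_normed (b i).hasCompactSupport_normed
      (b i).nonneg_normed hψ
  · refine tendstoLocallyUniformly_iff_forall_isCompact.2 fun K hK => ?_
    refine Metric.tendstoUniformlyOn_iff.2 fun ε hε => ?_
    obtain ⟨δ, hδ, h⟩ := Metric.mem_uniformity_dist.1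
      (hK.uniformContinuousAt_of_continuousAt ψ (fun a _ => hc.continuousAt)
        (Metric.dist_mem_uniformity (half_pos hε)))
    filter_upwards [tendsto_one_div_add_atTop_nhds_zero_nat.eventually (gt_mem_nhds hδ)]
      with i hi x hx
    rw [dist_comm]
    refine ((b i).dist_normed_convolution_le hc.aestronglyMeasurable fun y hy => ?_).trans_lt
      (half_lt_self hε)
    rw [dist_comm]
    exact (h (by rw [dist_comm]; exact (Metric.mem_ball.1 hy).trans hi) hx).le

/-- The integrands increase to the indicator of `U`; when `f` is smooth they are smooth test
functions, so such integrals determine the measure of bounded open sets. -/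
theorem tendsto_integral_smoothTransition (μ : Measure (E n)) [IsLocallyFiniteMeasure μ]
    {U : Set (E n)} (hU : IsOpen U) (hUb : Bornology.IsBounded U) {f : E n → ℝ}
    (hf : Continuous f) (hfs : Function.support f = U) (hf0 : ∀ x, 0 ≤ f x) :
    Tendsto (fun k : ℕ => ∫ x, Real.smoothTransition (k * f x) ∂μ) atTop (𝓝 (μ.real U)) := by
  have hzero : ∀ x ∉ U, f x = 0 := fun x hx => by
    rwa [← hfs, Function.notMem_support] at hx
  rw [← integral_indicator_one hU.measurableSet]
  refine tendsto_integral_filter_of_dominated_convergence (U.indicator 1) ?_ ?_ ?_ ?_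
  · exact Filter.Eventually.of_forall fun k =>
      (Real.smoothTransition.continuous.comp (continuous_const.mul hf)).aestronglyMeasurable
  · refine Filter.Eventually.of_forall fun k => Filter.Eventually.of_forall fun x => ?_
    rw [Real.norm_of_nonneg (Real.smoothTransition.nonneg _)]
    by_cases hx : x ∈ U
    · rw [Set.indicator_of_mem hx]
      exact Real.smoothTransition.le_one _
    · simp [Set.indicator_of_notMem hx, hzero x hx]
  · exact (integrable_indicator_iff hU.measurableSet).2 (integrableOn_const
      ((measure_mono subset_closure).trans_lt hUb.isCompact_closure.measure_lt_top).ne)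
  · refine Filter.Eventually.of_forall fun x => ?_
    by_cases hx : x ∈ U
    · have hpos : 0 < f x := (hf0 x).lt_of_ne' (by rwa [← Function.mem_support, hfs])
      refine tendsto_const_nhds.congr' ?_
      filter_upwards [(tendsto_natCast_atTop_atTop.atTop_mul_const hpos).eventually_ge_atTop 1]
        with k hk
      rw [Set.indicator_of_mem hx, Real.smoothTransition.one_of_one_le hk, Pi.one_apply]
    · simp [Set.indicator_of_notMem hx, hzero x hx]

theorem measure_eq_of_integral_contDiff_eq {μ ν : Measure (E n)} [IsLocallyFiniteMeasure μ]
    [IsLocallyFiniteMeasure ν]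
    (h : ∀ χ : E n → ℝ, ContDiff ℝ ∞ χ → HasCompactSupport χ → ∫ x, χ x ∂μ = ∫ x, χ x ∂ν) :
    μ = ν := by
  refine Measure.OuterRegular.ext_isOpen_isBounded fun U hU hUb => ?_
  obtain ⟨f, hfs, hf, hfr⟩ := hU.exists_contDiff_support_eq (n := ⊤)
  have hf0 : ∀ x, 0 ≤ f x := fun x => (hfr ⟨x, rfl⟩).1
  have hμ := tendsto_integral_smoothTransition μ hU hUb hf.continuous hfs hf0
  have hν := tendsto_integral_smoothTransition ν hU hUb hf.continuous hfs hf0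
  have heq : ∀ k : ℕ, ∫ x, Real.smoothTransition (k * f x) ∂μ =
      ∫ x, Real.smoothTransition (k * f x) ∂ν := fun k => by
    refine h _ (Real.smoothTransition.contDiff.comp (contDiff_const.mul hf)) ?_
    refine HasCompactSupport.of_support_subset_isCompact hUb.isCompact_closure fun x hx => ?_
    refine subset_closure ?_
    rw [← hfs, Function.mem_support]
    intro h0
    exact hx (by simp [h0])
  simp only [heq] at hμ
  have hreal := tendsto_nhds_unique hμ hν
  have hfin : ∀ (m : Measure (E n)) [IsLocallyFiniteMeasure m], m U ≠ ⊤ := fun m _ =>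
    ((measure_mono subset_closure).trans_lt hUb.isCompact_closure.measure_lt_top).ne
  exact (measureReal_eq_measureReal_iff (hfin μ) (hfin ν)).1 hreal

theorem IsMongeAmpere.unique (hψ : ConvexOn ℝ Set.univ ψ) {μ ν : Measure (E n)}
    (hμ : IsMongeAmpere ψ μ) (hν : IsMongeAmpere ψ ν) : μ = ν := by
  have := hμ.1
  have := hν.1
  obtain ⟨φ, hφ, hlim⟩ := exists_contDiff_convexOn_tendsto hψ
  exact measure_eq_of_integral_contDiff_eq fun χ hχ hχc =>
    tendsto_nhds_unique (hμ.2 φ hφ hlim χ hχ hχc) (hν.2 φ hφ hlim χ hχ hχc)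

theorem MA_eq_alexandrovMeasure (hψ : ConvexOn ℝ Set.univ ψ) : MA ψ = alexandrovMeasure ψ := by
  have h : ∃ μ, IsMongeAmpere ψ μ := ⟨_, isMongeAmpere_alexandrovMeasure hψ⟩
  rw [MA, dif_pos h]
  exact h.choose_spec.unique hψ (isMongeAmpere_alexandrovMeasure hψ)

/-! ### Support functions of convex bodies. -/

theorem inner_le_supportFn (K : ConvexBody (E n)) (x : E n) {y : E n} (hy : y ∈ K) :
    inner ℝ x y ≤ supportFn K x :=
  le_csSup (K.isCompact.image (by fun_prop)).bddAbove ⟨y, hy, rfl⟩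

theorem supportFn_le (K : ConvexBody (E n)) {x : E n} {c : ℝ}
    (h : ∀ y ∈ K, inner ℝ x y ≤ c) : supportFn K x ≤ c := by
  refine csSup_le (K.nonempty.image _) ?_
  rintro _ ⟨y, hy, rfl⟩
  exact h y hy

/-- A point outside `K` is strictly separated from it by a hyperplane, by Hahn-Banach. -/
theorem mem_iff_forall_inner_le_supportFn (K : ConvexBody (E n)) (y : E n) :
    y ∈ K ↔ ∀ x, inner ℝ x y ≤ supportFn K x := by
  refine ⟨fun hy x => inner_le_supportFn K x hy, fun h => ?_⟩
  by_contra hy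
  obtain ⟨f, u, hf, hu⟩ := geometric_hahn_banach_closed_point K.convex K.isCompact.isClosed hy
  have hin : ∀ z, inner ℝ ((InnerProductSpace.toDual ℝ (E n)).symm f) z = f z := fun z =>
    InnerProductSpace.toDual_symm_apply
  have h1 := h ((InnerProductSpace.toDual ℝ (E n)).symm f)
  rw [hin] at h1
  have h2 := supportFn_le K (x := (InnerProductSpace.toDual ℝ (E n)).symm f) (c := u)
    fun z hz => by rw [hin]; exact (hf z hz).le
  linarith

theorem supportFn_injective : Function.Injective (supportFn (n := n)) := fun K L h => by
  ext y
  change y ∈ K ↔ y ∈ L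
  rw [mem_iff_forall_inner_le_supportFn, h, mem_iff_forall_inner_le_supportFn]

theorem convexOn_supportFn (K : ConvexBody (E n)) : ConvexOn ℝ Set.univ (supportFn K) := by
  refine ⟨convex_univ, fun x _ y _ a b ha hb _ => supportFn_le K fun z hz => ?_⟩
  rw [inner_add_left, real_inner_smul_left, real_inner_smul_left]
  exact add_le_add (mul_le_mul_of_nonneg_left (inner_le_supportFn K x hz) ha)
    (mul_le_mul_of_nonneg_left (inner_le_supportFn K y hz) hb)

theorem supportFn_zero (K : ConvexBody (E n)) : supportFn K 0 = 0 := by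
  obtain ⟨y, hy⟩ := K.nonempty
  refine le_antisymm (supportFn_le K fun z _ => by rw [inner_zero_left]) ?_
  simpa using inner_le_supportFn K 0 hy

theorem supportFn_smul_le (K : ConvexBody (E n)) {c : ℝ} (hc : 0 ≤ c) (x : E n) :
    supportFn K (c • x) ≤ c * supportFn K x :=
  supportFn_le K fun y hy => by
    rw [real_inner_smul_left]
    exact mul_le_mul_of_nonneg_left (inner_le_supportFn K x hy) hc

theorem isSubgradient_supportFn_zero (K : ConvexBody (E n)) {p : E n} (hp : p ∈ K) :
    IsSubgradient (supportFn K) 0 p := fun y => by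
  rw [supportFn_zero, zero_add, sub_zero, real_inner_comm]
  exact inner_le_supportFn K y hp

/-- For a subgradient `p` at `x`, subadditivity gives `h x + ⟨p, z⟩ ≤ h (x + z) ≤ h x + h z`;
cancelling `h x` puts `p` in `K`. -/
theorem subgradientRange_supportFn (K : ConvexBody (E n)) :
    subgradientRange (supportFn K) = K := by
  ext p
  refine ⟨fun ⟨x, hx⟩ => (mem_iff_forall_inner_le_supportFn K p).2 fun z => ?_,
    fun hp => ⟨0, isSubgradient_supportFn_zero K hp⟩⟩
  have h1 := hx (x + z)
  have h2 := (convexOn_supportFn K).2 (Set.mem_univ ((2 : ℝ) • x)) (Set.mem_univ ((2 : ℝ) • z))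
    (one_half_pos (α := ℝ)).le (one_half_pos (α := ℝ)).le (by norm_num)
  rw [smul_smul, smul_smul] at h2
  norm_num at h2
  have h3 := supportFn_smul_le K zero_le_two x
  have h4 := supportFn_smul_le K zero_le_two z
  rw [add_sub_cancel_left, real_inner_comm] at h1
  linarith

theorem alexandrovMeasure_supportFn (K : ConvexBody (E n)) :
    alexandrovMeasure (supportFn K) = volume (K : Set (E n)) • Measure.dirac 0 := by
  have hc := continuous_of_convexOn (convexOn_supportFn K)
  have hae : contactPoint (supportFn K)
      =ᵐ[volume.restrict (subgradientRange (supportFn K))] fun _ => (0 : E n) := by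
    filter_upwards [ae_restrict_of_ae (ae_isSubgradient_unique hc),
      ae_restrict_mem (measurableSet_subgradientRange hc)] with p hp hpS
    refine hp _ _ (isSubgradient_contactPoint hpS) (isSubgradient_supportFn_zero K ?_)
    rw [subgradientRange_supportFn] at hpS
    exact hpS
  rw [alexandrovMeasure, Measure.map_congr hae, Measure.map_const, Measure.restrict_apply_univ,
    subgradientRange_supportFn]

/-! ### The indicator function is a support function. -/

theorem monotone_slope_of_convexOn (hψ : ConvexOn ℝ Set.univ ψ) (x : E n) {s t : ℝ} (hs : 0 < s)
    (hst : s ≤ t) : (ψ (s • x) - ψ 0) / s ≤ (ψ (t • x) - ψ 0) / t := by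
  have ht : 0 < t := hs.trans_le hst
  have h := hψ.2 (Set.mem_univ 0) (Set.mem_univ (t • x))
    (sub_nonneg.2 ((div_le_one ht).2 hst)) (div_nonneg hs.le ht.le) (sub_add_cancel _ _)
  rw [smul_zero, zero_add, smul_smul, div_mul_cancel₀ _ ht.ne', smul_eq_mul, smul_eq_mul] at h
  rw [div_le_div_iff₀ hs ht]
  have h' := mul_le_mul_of_nonneg_right h ht.le
  have e : ((1 - s / t) * ψ 0 + s / t * ψ (t • x)) * t = (t - s) * ψ 0 + s * ψ (t • x) := by
    field_simp
  rw [e] at h'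
  linarith

theorem tendsto_indicatorFn (hψ : ConvexOn ℝ Set.univ ψ) (hg : LinearGrowth ψ) (x : E n) :
    Tendsto (fun t : ℝ => ψ (t • x) / t) atTop (𝓝 (indicatorFn ψ x)) := by
  obtain ⟨A, B, hAB⟩ := hg
  have hpos : ∀ t : ℝ, 0 < max t 1 := fun t => one_pos.trans_le (le_max_right _ _)
  -- Replacing `t` by `max t 1` makes the difference quotient monotone and bounded on all of `ℝ`
  -- without changing its limit.
  have hmono : Monotone fun t : ℝ => (ψ (max t 1 • x) - ψ 0) / max t 1 := fun s t hst =>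
    monotone_slope_of_convexOn hψ x (hpos s) (max_le_max_right 1 hst)
  have hbdd : BddAbove (Set.range fun t : ℝ => (ψ (max t 1 • x) - ψ 0) / max t 1) := by
    refine ⟨A * ‖x‖ + |B - ψ 0|, ?_⟩
    rintro _ ⟨t, rfl⟩
    have h1 := hAB (max t 1 • x)
    rw [norm_smul, Real.norm_of_nonneg (hpos t).le] at h1
    dsimp only
    rw [div_le_iff₀ (hpos t)]
    have h2 := mul_le_mul_of_nonneg_left (le_max_right t 1) (abs_nonneg (B - ψ 0))
    linarith [le_abs_self (B - ψ 0)]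
  have hlim := (tendsto_atTop_ciSup hmono hbdd).add
    ((tendsto_const_nhds (x := ψ 0)).div_atTop tendsto_id)
  refine tendsto_nhds_limUnder ⟨_, hlim.congr' ?_⟩
  filter_upwards [eventually_ge_atTop 1] with t ht
  rw [max_eq_left ht, id, ← add_div, sub_add_cancel]

theorem tendsto_indicatorFn_mul (hψ : ConvexOn ℝ Set.univ ψ) (hg : LinearGrowth ψ) (x : E n)
    {c : ℝ} (hc : 0 < c) :
    Tendsto (fun t : ℝ => ψ (t • c • x) / t) atTop (𝓝 (c * indicatorFn ψ x)) := by
  refine (((tendsto_indicatorFn hψ hg x).comp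
    (tendsto_id.atTop_mul_const hc)).const_mul c).congr fun t => ?_
  simp only [Function.comp_apply, id, smul_smul]
  rw [mul_comm t c, mul_div_assoc', mul_div_mul_left _ _ hc.ne']

theorem indicatorFn_smul (hψ : ConvexOn ℝ Set.univ ψ) (hg : LinearGrowth ψ) (x : E n)
    {c : ℝ} (hc : 0 < c) : indicatorFn ψ (c • x) = c * indicatorFn ψ x :=
  tendsto_nhds_unique (tendsto_indicatorFn hψ hg (c • x)) (tendsto_indicatorFn_mul hψ hg x hc)

/-- Midpoint convexity at `2tx` and `2ty`, divided by `t`, in the limit. -/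
theorem indicatorFn_add_le (hψ : ConvexOn ℝ Set.univ ψ) (hg : LinearGrowth ψ) (x y : E n) :
    indicatorFn ψ (x + y) ≤ indicatorFn ψ x + indicatorFn ψ y := by
  have hlim := ((tendsto_indicatorFn_mul hψ hg x two_pos).add
    (tendsto_indicatorFn_mul hψ hg y two_pos)).const_mul (1 / 2)
  have hle := le_of_tendsto_of_tendsto (tendsto_indicatorFn hψ hg (x + y)) hlim ?_
  · linarith
  · filter_upwards [eventually_gt_atTop 0] with t ht
    have h := hψ.2 (Set.mem_univ (t • (2 : ℝ) • x)) (Set.mem_univ (t • (2 : ℝ) • y))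
      (one_half_pos (α := ℝ)).le (one_half_pos (α := ℝ)).le (by norm_num)
    have e : (1 / 2 : ℝ) • t • (2 : ℝ) • x + (1 / 2 : ℝ) • t • (2 : ℝ) • y = t • (x + y) := by
      module
    rw [e, smul_eq_mul, smul_eq_mul, ← mul_add] at h
    rw [← add_div, mul_div_assoc']
    exact div_le_div_of_nonneg_right h ht.le

theorem indicatorFn_zero (ψ : E n → ℝ) : indicatorFn ψ 0 = 0 := by
  refine Tendsto.limUnder_eq ?_
  simp only [smul_zero]
  exact tendsto_const_nhds.div_atTop tendsto_id

theorem exists_indicatorFn_le (hψ : ConvexOn ℝ Set.univ ψ) (hg : LinearGrowth ψ) :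
    ∃ A, ∀ x, indicatorFn ψ x ≤ A * ‖x‖ := by
  have hg' := hg
  obtain ⟨A, B, hAB⟩ := hg
  refine ⟨A, fun x => ?_⟩
  have hlim := (tendsto_const_nhds (x := A * ‖x‖)).add
    ((tendsto_const_nhds (x := B)).div_atTop (tendsto_id (x := atTop)))
  rw [add_zero] at hlim
  refine le_of_tendsto_of_tendsto (tendsto_indicatorFn hψ hg' x) hlim ?_
  filter_upwards [eventually_gt_atTop 0] with t ht
  have h := hAB (t • x)
  rw [norm_smul, Real.norm_of_nonneg ht.le] at h
  rw [id, div_le_iff₀ ht, add_mul, div_mul_cancel₀ _ ht.ne']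
  linarith

theorem IsSubgradient.inner_le_indicatorFn (hψ : ConvexOn ℝ Set.univ ψ) (hg : LinearGrowth ψ)
    {x p : E n} (h : IsSubgradient ψ x p) (y : E n) : inner ℝ y p ≤ indicatorFn ψ y := by
  have hlim := ((tendsto_const_nhds (x := ψ x - inner ℝ p x)).div_atTop
    (tendsto_id (x := atTop))).add (tendsto_const_nhds (x := inner ℝ y p))
  rw [zero_add] at hlim
  refine le_of_tendsto_of_tendsto hlim (tendsto_indicatorFn hψ hg y) ?_
  filter_upwards [eventually_gt_atTop 0] with t ht
  have h1 := h (t • y)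
  rw [inner_sub_right, inner_smul_right, real_inner_comm] at h1
  rw [id, le_div_iff₀ ht, add_mul, div_mul_cancel₀ _ ht.ne', real_inner_comm]
  linarith [real_inner_comm p y, real_inner_comm p x]

/-- Since `ψ°` is sublinear, Hahn-Banach extends the functional `c • x ↦ c * ψ° x` from the line to
the whole space below `ψ°`, and Riesz represents it by a vector. -/
theorem exists_inner_eq_indicatorFn (hψ : ConvexOn ℝ Set.univ ψ) (hg : LinearGrowth ψ) (x : E n) :
    ∃ y : E n, (∀ z, inner ℝ z y ≤ indicatorFn ψ z) ∧ inner ℝ x y = indicatorFn ψ x := by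
  have key : ∀ f : E n →ₗ.[ℝ] ℝ, (∀ z : f.domain, f z ≤ indicatorFn ψ z) →
      ∃ y : E n, (∀ z, inner ℝ z y ≤ indicatorFn ψ z) ∧ ∀ z : f.domain, inner ℝ (z : E n) y = f z :=
    fun f hf => by
      obtain ⟨g, hgf, hgN⟩ := exists_extension_of_le_sublinear f (indicatorFn ψ)
        (fun c hc z => indicatorFn_smul hψ hg z hc) (indicatorFn_add_le hψ hg) hf
      have hin : ∀ z, inner ℝ z ((InnerProductSpace.toDual ℝ (E n)).symm
          (LinearMap.toContinuousLinearMap g)) = g z := fun z => by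
        rw [real_inner_comm, InnerProductSpace.toDual_symm_apply]
        rfl
      exact ⟨_, fun z => (hin z).trans_le (hgN z), fun z => (hin z).trans (hgf z)⟩
  -- For `x = 0` there is no line, and the zero subspace is extended instead.
  rcases eq_or_ne x 0 with rfl | hx
  · obtain ⟨y, hy, -⟩ := key ⊥ fun z => by
      obtain ⟨z, hz⟩ := z
      obtain rfl : z = 0 := hz
      rw [indicatorFn_zero]
      exact (LinearPMap.map_zero ⊥).le
    exact ⟨y, hy, by rw [inner_zero_left, indicatorFn_zero]⟩
  · obtain ⟨y, hy, hxy⟩ := key (LinearPMap.mkSpanSingleton x (indicatorFn ψ x) hx) fun z => by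
      obtain ⟨z, hz⟩ := z
      obtain ⟨c, rfl⟩ := Submodule.mem_span_singleton.1 hz
      rw [LinearPMap.mkSpanSingleton'_apply, RingHom.id_apply, smul_eq_mul]
      dsimp only
      rcases lt_trichotomy c 0 with hc | rfl | hc
      -- For negative `c`: `0 = ψ° 0 ≤ ψ° (c x) + ψ° (-c x)`, and the last term is `-c * ψ° x`.
      · have h1 := indicatorFn_add_le hψ hg (c • x) ((-c) • x)
        rw [← add_smul, add_neg_cancel, zero_smul, indicatorFn_zero,
          indicatorFn_smul hψ hg x (neg_pos.2 hc)] at h1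
        linarith
      · rw [zero_mul, zero_smul, indicatorFn_zero]
      · rw [indicatorFn_smul hψ hg x hc]
    refine ⟨y, hy, ?_⟩
    have h1 := hxy ⟨x, Submodule.mem_span_singleton_self x⟩
    rw [LinearPMap.mkSpanSingleton_apply] at h1
    exact h1

theorem exists_indicatorFn_eq_supportFn (hψ : ConvexOn ℝ Set.univ ψ) (hg : LinearGrowth ψ) :
    ∃ K : ConvexBody (E n), indicatorFn ψ = supportFn K := by
  have hset : {y : E n | ∀ x, inner ℝ x y ≤ indicatorFn ψ x} =
      ⋂ x, {y : E n | inner ℝ x y ≤ indicatorFn ψ x} := by ext; simp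
  obtain ⟨A, hA⟩ := exists_indicatorFn_le hψ hg
  let K : ConvexBody (E n) :=
    { carrier := {y | ∀ x, inner ℝ x y ≤ indicatorFn ψ x}
      convex' := by
        rw [hset]
        exact convex_iInter fun x => convex_halfSpace_le (innerSL ℝ x).isLinear _
      isCompact' := by
        refine Metric.isCompact_of_isClosed_isBounded ?_ ?_
        · rw [hset]
          exact isClosed_iInter fun x => isClosed_le (by fun_prop) continuous_const
        · refine isBounded_iff_forall_norm_le.2 ⟨|A|, fun y hy => ?_⟩
          have h1 := (hy y).trans (hA y)
          rw [real_inner_self_eq_norm_mul_norm] at h1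
          by_contra! hlt
          have h2 := (abs_nonneg A).trans_lt hlt
          nlinarith [le_abs_self A]
      nonempty' := (exists_inner_eq_indicatorFn hψ hg 0).imp fun y hy => hy.1 }
  refine ⟨K, funext fun x => le_antisymm ?_ (supportFn_le K fun y hy => hy x)⟩
  obtain ⟨y, hy, hxy⟩ := exists_inner_eq_indicatorFn hψ hg x
  rw [← hxy]
  exact inner_le_supportFn K x hy

/-! ### The total mass. -/

theorem inner_lt_supportFn_of_mem_interior (K : ConvexBody (E n)) {p x : E n}
    (hp : p ∈ interior (K : Set (E n))) (hx : x ≠ 0) : inner ℝ p x < supportFn K x := by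
  obtain ⟨ε, hε, hball⟩ := Metric.isOpen_iff.1 isOpen_interior p hp
  have hx' : 0 < ‖x‖ := norm_pos_iff.2 hx
  have hmem : p + (ε / 2 / ‖x‖) • x ∈ K := interior_subset (hball (by
    rw [mem_ball_iff_norm, add_sub_cancel_left, norm_smul, Real.norm_of_nonneg (by positivity),
      div_mul_cancel₀ _ hx'.ne']
    exact half_lt_self hε))
  have h := inner_le_supportFn K x hmem
  rw [inner_add_right, inner_smul_right, real_inner_self_eq_norm_mul_norm] at h
  have : 0 < ε / 2 / ‖x‖ * (‖x‖ * ‖x‖) := by positivity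
  rw [real_inner_comm]
  linarith

/-- For interior `p`, `⟨p, u⟩ < ψ° u` for every unit `u`, so `g = ψ - ⟨p, ·⟩` eventually exceeds `g
0` along each ray. Compactness of the unit sphere gives one radius for all directions, so `g` has a
minimum, at which `p` is a subgradient. -/
theorem interior_subset_subgradientRange (hψ : ConvexOn ℝ Set.univ ψ) (hg : LinearGrowth ψ)
    {K : ConvexBody (E n)} (hK : indicatorFn ψ = supportFn K) :
    interior (K : Set (E n)) ⊆ subgradientRange ψ := fun p hp => by
  set g : E n → ℝ := fun x => ψ x - inner ℝ p x with hgdef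
  have hgc : ConvexOn ℝ Set.univ g := convexOn_sub_inner hψ p
  have hcont := continuous_of_convexOn hgc
  let V : ℕ → Set (E n) := fun k => {u | g 0 < g (((k : ℝ) + 1) • u)}
  have hpos : ∀ k : ℕ, 0 < (k : ℝ) + 1 := fun k => by positivity
  -- Slopes from the origin increase, so a ray that has risen above `g 0` stays above it. The shift
  -- to `k + 1` keeps the radius positive.
  have hV : Monotone V := fun k m hkm u hu => by
    have h1 := monotone_slope_of_convexOn hgc u (hpos k) (t := (m : ℝ) + 1) (by gcongr)
    have h2 : 0 < (g (((k : ℝ) + 1) • u) - g 0) / ((k : ℝ) + 1) :=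
      div_pos (sub_pos.2 hu) (hpos k)
    exact sub_pos.1 ((div_pos_iff_of_pos_right (hpos m)).1 (h2.trans_le h1))
  have hcover : Metric.sphere (0 : E n) 1 ⊆ ⋃ k, V k := fun u hu => by
    have hu0 : u ≠ 0 := by
      rintro rfl
      simp at hu
    have hlt := inner_lt_supportFn_of_mem_interior K hp hu0
    rw [← hK] at hlt
    by_contra hnot
    simp only [Set.mem_iUnion, not_exists] at hnot
    have hat : Tendsto (fun k : ℕ => (k : ℝ) + 1) atTop atTop :=
      tendsto_atTop_add_const_right _ _ tendsto_natCast_atTop_atTop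
    have hlim := (tendsto_indicatorFn hψ hg u).comp hat
    have hlim2 := ((tendsto_const_nhds (x := g 0)).div_atTop hat).add
      (tendsto_const_nhds (x := inner ℝ p u))
    rw [zero_add] at hlim2
    -- If `g` never exceeded `g 0` at these radii, dividing by the radius would give `ψ° u ≤ ⟨p, u⟩`
    -- in the limit.
    refine hlt.not_ge (le_of_tendsto_of_tendsto' hlim hlim2 fun k => ?_)
    have h1 : g (((k : ℝ) + 1) • u) ≤ g 0 := not_lt.1 (hnot k)
    have h2 : g (((k : ℝ) + 1) • u) = ψ (((k : ℝ) + 1) • u) - ((k : ℝ) + 1) * inner ℝ p u := by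
      rw [hgdef]
      dsimp only
      rw [inner_smul_right]
    rw [Function.comp_apply, div_le_iff₀ (hpos k), add_mul, div_mul_cancel₀ _ (hpos k).ne']
    linarith
  obtain ⟨k, hk⟩ := (isCompact_sphere (0 : E n) 1).elim_directed_cover V
    (fun k => isOpen_lt continuous_const (hcont.comp (continuous_const_smul _))) hcover
    hV.directed_le
  obtain ⟨z, hz⟩ := exists_forall_le_of_lt_sphere hgc (x := 0) (hpos k) fun y hy => by
    rw [sub_zero] at hy
    have hmem : ((k : ℝ) + 1)⁻¹ • y ∈ V k := hk (by
      rw [mem_sphere_zero_iff_norm, norm_smul, hy, norm_inv, Real.norm_of_nonneg (hpos k).le,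
        inv_mul_cancel₀ (hpos k).ne'])
    have h1 : g 0 < g (((k : ℝ) + 1) • ((k : ℝ) + 1)⁻¹ • y) := hmem
    rwa [smul_inv_smul₀ (hpos k).ne'] at h1
  exact ⟨z, isSubgradient_iff.2 hz⟩

theorem volume_subgradientRange (hψ : ConvexOn ℝ Set.univ ψ) (hg : LinearGrowth ψ)
    {K : ConvexBody (E n)} (hK : indicatorFn ψ = supportFn K) :
    volume (subgradientRange ψ) = volume (K : Set (E n)) := by
  refine le_antisymm (measure_mono ?_) ?_
  · rintro p ⟨x, hx⟩
    refine (mem_iff_forall_inner_le_supportFn K p).2 fun y => ?_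
    rw [← hK]
    exact hx.inner_le_indicatorFn hψ hg y
  · rw [← measure_congr (interior_ae_eq_of_null_frontier
      (Convex.addHaar_frontier volume K.convex))]
    exact measure_mono (interior_subset_subgradientRange hψ hg hK)

end SuperForms

theorem mainTheorem7 (n : ℕ) :
    (∀ ψ : SuperForms.E n → ℝ, ConvexOn ℝ Set.univ ψ → SuperForms.LinearGrowth ψ →
      (SuperForms.IsMongeAmpere ψ (SuperForms.MA ψ) ∧
        ∀ μ, SuperForms.IsMongeAmpere ψ μ → μ = SuperForms.MA ψ) ∧
      (∀ x, Tendsto (fun t : ℝ => ψ (t • x) / t) atTop (𝓝 (SuperForms.indicatorFn ψ x))) ∧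
      ∃ K : ConvexBody (SuperForms.E n),
        SuperForms.indicatorFn ψ = SuperForms.supportFn K ∧
        (∀ L : ConvexBody (SuperForms.E n),
          SuperForms.indicatorFn ψ = SuperForms.supportFn L → L = K) ∧
        SuperForms.MA ψ Set.univ = volume (K : Set (SuperForms.E n))) ∧
    (∀ K : ConvexBody (SuperForms.E n),
      SuperForms.IsMongeAmpere (SuperForms.supportFn K) (SuperForms.MA (SuperForms.supportFn K)) ∧
      SuperForms.MA (SuperForms.supportFn K) =
        volume (K : Set (SuperForms.E n)) • Measure.dirac 0) := by
  refine ⟨fun ψ hψ hg => ?_, fun K => ?_⟩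
  · have hMA := SuperForms.isMongeAmpere_alexandrovMeasure hψ
    rw [SuperForms.MA_eq_alexandrovMeasure hψ]
    obtain ⟨K, hK⟩ := SuperForms.exists_indicatorFn_eq_supportFn hψ hg
    refine ⟨⟨hMA, fun μ hμ => hμ.unique hψ hMA⟩, SuperForms.tendsto_indicatorFn hψ hg, K, hK,
      fun L hL => SuperForms.supportFn_injective (hL.symm.trans hK), ?_⟩
    rw [SuperForms.alexandrovMeasure_univ (SuperForms.continuous_of_convexOn hψ),
      SuperForms.volume_subgradientRange hψ hg hK]
  · have hK := SuperForms.convexOn_supportFn K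
    rw [SuperForms.MA_eq_alexandrovMeasure hK]
    exact ⟨SuperForms.isMongeAmpere_alexandrovMeasure hK,
      SuperForms.alexandrovMeasure_supportFn K⟩
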